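/- **Setting.** Let $1\le k\le d$. Let $\mathcal M\subset\mathbb R^n$ be a smooth embedded $d$-dimensional submanifold of positive reach whose normal curvatures are at most $\kappa\ge 0$ (that is, $\|\mathrm{II}(u,u)\|\le\kappa\|u\|^2$), let $0<\rho<\mathrm{reach}(\mathcal M)$, let $\mathcal T_\rho=\{x:\mathrm{dist}(x,\mathcal M)\le\rho\}$, and let $\pi:\mathcal T_\rho\to\mathcal M$ be the nearest-point projection. Let $\Phi:\mathbb R^n\to\mathcal T_\rho$ be a backward probability-flow map: for some $T>0$, an integrable schedule $\beta\ge0$ on $[0,T]$ and a score $s(x,t)$, $\Phi(z)=x(0)$, where $x$ solves $\dot x=-\tfrac12\beta(t)x-\tfrac12\beta(t)s(x,t)$ on $[0,T]$ with $x(T)=z$ (a solution exists for every $z$, and all solutions have the same value at $0$). Put $\Pi=\pi\circ\Phi$. Fix $z$ and suppose that, on the ball of radius $r>0$ around $z$, $\Phi$ is $C^3$ with $\|D^2\Phi\|,\|D^3\Phi\|\le B$. For perturbations $\xi_1,\dots,\xi_k\in\mathbb R^n$ and $\sigma>0$ let $\Xi=[\xi_1,\dots,\xi_k]$, $\Delta_i=\Phi(z+\sigma\xi_i)-\Phi(z)$,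 $S_k=\mathrm{span}\{\Delta_1,\dots,\Delta_k\}$, $T=T_{\Pi(z)}\mathcal M$ and $s_{\min}=\sigma_{\min}(D\Pi(z)\Xi)$ (the $k$-th singular value). $P_T^\perp$ and $P_{S_k}$ are the orthogonal projectors onto $T^\perp$ and $S_k$, and $\|\cdot\|$ is the spectral norm. Suppose that $s_{\min}\ge s_0>0$, that $$\|P_T^\perp D\Phi(z)\|\le L_\perp\rho,\qquad \|P_T^\perp R\|\le C_{\rm curv}\,\kappa\,\sigma^2\|\Xi\|^2,$$ where $R=[R_1,\dots,R_k]$, $R_i=\tfrac{\sigma^2}{2}D^2\Phi(z)[\xi_i,\xi_i]$, and that $\mathrm{reach}(\mathcal M)\ge\tau>0$. **Theorem.** 1. There is a constant $C_3\ge 0$, depending only on $n,d,k,B$, such that for all $\xi_1,\dots,\xi_k$ and all $\tau,r,s_0,\varepsilon>0$ there are $\sigma_0,\rho_0>0$ such that, for all $\mathcal M,\Phi,z,\kappa,L_\perp,C_{\rm curv}$ as above and all $\sigma\le\sigma_0$, $\rho\le\rho_0$, $$\|P_T^\perp P_{S_k}\|\le(1+\varepsilon)\left(\frac{L_\perp\rho\|\Xi\|}{s_{\min}}+\frac{C_{\rm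 curv}\kappa\sigma\|\Xi\|^2}{s_{\min}}\right)+\frac{C_3\sigma^2\|\Xi\|^3}{s_{\min}}.$$ Moreover, with the same $C_3$, for all $\xi_1,\dots,\xi_k,\tau,r,s_0$ there is $\sigma_0>0$ such that for every fixed $\sigma\in(0,\sigma_0]$, all $L_\perp,C_{\rm curv}$ and every $\eta>0$ there is $\delta>0$ with $\|P_T^\perp P_{S_k}\|\le C_3\sigma^2\|\Xi\|^3/s_{\min}+\eta$ whenever $\rho,\kappa\le\delta$. 2. For all $\xi_1,\dots,\xi_k$, all $\tau,r,s_0,\Lambda>0$ and all $\kappa,L_\perp,C_{\rm curv}$ there are $C_3\ge0$ and $\sigma_0,\rho_0>0$ such that, for all $\mathcal M,\Phi,z$ as above and all $\sigma\le\sigma_0$, $\rho\le\min(\rho_0,\Lambda\sigma)$, $$\|P_T^\perp P_{S_k}\|\le\frac{L_\perp\rho\|\Xi\|}{s_{\min}}+\frac{C_{\rm curv}\kappa\sigma\|\Xi\|^2}{s_{\min}}+\frac{C_3\sigma^2\|\Xi\|^3}{s_{\min}}.$$ 3. For fixed $\sigma$, $\Xi$, $s_{\min}$, $L_\perp$, $C_{\rm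 curv}$, the first two terms $L_\perp\rho\|\Xi\|/s_{\min}$ and $C_{\rm curv}\kappa\sigma\|\Xi\|^2/s_{\min}$ tend to $0$ as $\rho\to0$ and $\kappa\to0$. -/

import Mathlib

open Set Filter Topology MeasureTheory
open scoped ENNReal ContDiff

noncomputable section

/-- `M ⊆ ℝⁿ` is a smooth embedded `d`-dimensional submanifold: around each of its points there is a
smooth chart of the ambient space which flattens `M` to a `d`-dimensional linear subspace. -/
def IsSmoothSubmanifold {n : ℕ} (d : ℕ) (M : Set (EuclideanSpace ℝ (Fin n))) : Prop :=
  ∀ p ∈ M, ∃ (e : OpenPartialHomeomorph (EuclideanSpace ℝ (Fin n)) (EuclideanSpace ℝ (Fin n)))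
    (W : Submodule ℝ (EuclideanSpace ℝ (Fin n))),
    p ∈ e.source ∧ ContDiffOn ℝ ∞ e e.source ∧ ContDiffOn ℝ ∞ e.symm e.target ∧
      Module.finrank ℝ W = d ∧ ∀ x ∈ e.source, x ∈ M ↔ e x ∈ W

/-- The tangent space `T_p M`: the linear span of the velocities at `p` of curves in `M`
(for a submanifold the velocities already form a subspace). -/
def tangentSubspace {n : ℕ} (M : Set (EuclideanSpace ℝ (Fin n))) (p : EuclideanSpace ℝ (Fin n)) :
    Submodule ℝ (EuclideanSpace ℝ (Fin n)) :=
  Submodule.span ℝ {v | ∃ γ : ℝ → EuclideanSpace ℝ (Fin n),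
    (∀ t, γ t ∈ M) ∧ γ 0 = p ∧ HasDerivAt γ v 0}

/-- The reach of `M`: the supremum of the radii `r` such that every point at distance less than `r`
from `M` has exactly one nearest point in `M`. -/
def reach {n : ℕ} (M : Set (EuclideanSpace ℝ (Fin n))) : ℝ≥0∞ :=
  sSup {r : ℝ≥0∞ | ∀ x, Metric.infEDist x M < r →
    ∃! y, y ∈ M ∧ edist x y = Metric.infEDist x M}

open Classical in
/-- The nearest-point projection `π` onto `M` (with the value `x` at a point `x` which has no
nearest point in `M`). -/
def nearestPoint {n : ℕ} (M : Set (EuclideanSpace ℝ (Fin n))) (x : EuclideanSpace ℝ (Fin n)) :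
    EuclideanSpace ℝ (Fin n) :=
  if h : ∃ y, y ∈ M ∧ edist x y = Metric.infEDist x M then h.choose else x

/-- All normal curvatures of `M` are at most `κ`: for every `C²` curve in `M`, the normal part of
its acceleration is at most `κ` times its squared speed. Equivalently, the second fundamental form
satisfies `‖II(u, u)‖ ≤ κ ‖u‖²`. -/
def HasCurvatureBound {n : ℕ} (M : Set (EuclideanSpace ℝ (Fin n))) (κ : ℝ) : Prop :=
  0 ≤ κ ∧ ∀ γ : ℝ → EuclideanSpace ℝ (Fin n), ContDiff ℝ 2 γ → (∀ t, γ t ∈ M) →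
    ‖(tangentSubspace M (γ 0))ᗮ.starProjection (deriv (deriv γ) 0)‖ ≤ κ * ‖deriv γ 0‖ ^ 2

/-- The probability-flow vector field `u(x, t) = -½ β(t) x - ½ β(t) s(x, t)` of the
variance-preserving diffusion with noise schedule `β` and score `s`. -/
def pfField {n : ℕ} (β : ℝ → ℝ)
    (s : EuclideanSpace ℝ (Fin n) → ℝ → EuclideanSpace ℝ (Fin n))
    (x : EuclideanSpace ℝ (Fin n)) (t : ℝ) : EuclideanSpace ℝ (Fin n) :=
  -(((1 / 2 : ℝ) * β t) • x) - ((1 / 2 : ℝ) * β t) • s x t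

/-- `X` solves `ẋ = u(x, t)` on `[0, T]` with terminal value `X(T) = z`
(in integrated form, as the schedule is only assumed to be integrable). -/
def IsBackwardSolution {n : ℕ}
    (u : EuclideanSpace ℝ (Fin n) → ℝ → EuclideanSpace ℝ (Fin n)) (T : ℝ)
    (z : EuclideanSpace ℝ (Fin n)) (X : ℝ → EuclideanSpace ℝ (Fin n)) : Prop :=
  ContinuousOn X (Icc 0 T) ∧ IntervalIntegrable (fun t => u (X t) t) volume 0 T ∧
    ∀ t ∈ Icc 0 T, X t = z - ∫ s in t..T, u (X s) s

/-- `Φ` is a backward probability-flow map: for some schedule, score and horizon, every terminal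
value `z` admits a solution of the probability-flow equation on `[0, T]`, and `Φ z` is its
(well-defined) value at time `0`. -/
def IsProbabilityFlowMap {n : ℕ}
    (Φ : EuclideanSpace ℝ (Fin n) → EuclideanSpace ℝ (Fin n)) : Prop :=
  ∃ (β : ℝ → ℝ) (s : EuclideanSpace ℝ (Fin n) → ℝ → EuclideanSpace ℝ (Fin n)) (T : ℝ),
    0 < T ∧ (∀ t, 0 ≤ β t) ∧ IntervalIntegrable β volume 0 T ∧
      ∀ z, (∃ X, IsBackwardSolution (pfField β s) T z X) ∧
        ∀ X, IsBackwardSolution (pfField β s) T z X → X 0 = Φ z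

/-- The `n × k` matrix `[v₁, …, v_k]` with columns `v i`, as an operator `ℝᵏ → ℝⁿ`; its norm is the
spectral norm. -/
def colMatrix {n k : ℕ} (v : Fin k → EuclideanSpace ℝ (Fin n)) :
    EuclideanSpace ℝ (Fin k) →L[ℝ] EuclideanSpace ℝ (Fin n) :=
  ∑ i, (EuclideanSpace.proj i : EuclideanSpace ℝ (Fin k) →L[ℝ] ℝ).smulRight (v i)

/-- The composition `Π = π ∘ Φ`. -/
def footMap {n : ℕ} (M : Set (EuclideanSpace ℝ (Fin n)))
    (Φ : EuclideanSpace ℝ (Fin n) → EuclideanSpace ℝ (Fin n)) :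
    EuclideanSpace ℝ (Fin n) → EuclideanSpace ℝ (Fin n) :=
  fun w => nearestPoint M (Φ w)

/-- `s_min = σ_min(DΠ(z) Ξ)`, the `k`-th (smallest) singular value of the `n × k` matrix
`DΠ(z) Ξ`. Mathlib numbers the singular values from `0`. -/
def tangentSignal {n k : ℕ} (M : Set (EuclideanSpace ℝ (Fin n)))
    (Φ : EuclideanSpace ℝ (Fin n) → EuclideanSpace ℝ (Fin n)) (z : EuclideanSpace ℝ (Fin n))
    (ξ : Fin k → EuclideanSpace ℝ (Fin n)) : ℝ :=
  ((fderiv ℝ (footMap M Φ) z).comp (colMatrix ξ)).toLinearMap.singularValues (k - 1)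

/-- The tangent space `T = T_{Π(z)} M` at the footpoint of `Φ(z)`. -/
def footTangent {n : ℕ} (M : Set (EuclideanSpace ℝ (Fin n)))
    (Φ : EuclideanSpace ℝ (Fin n) → EuclideanSpace ℝ (Fin n)) (z : EuclideanSpace ℝ (Fin n)) :
    Submodule ℝ (EuclideanSpace ℝ (Fin n)) :=
  tangentSubspace M (footMap M Φ z)

/-- The secant span `S_k = span {Δ₁, …, Δ_k}`, `Δ_i = Φ(z + σ ξ_i) - Φ(z)`. -/
def secantSpan {n k : ℕ} (Φ : EuclideanSpace ℝ (Fin n) → EuclideanSpace ℝ (Fin n))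
    (z : EuclideanSpace ℝ (Fin n)) (σ : ℝ) (ξ : Fin k → EuclideanSpace ℝ (Fin n)) :
    Submodule ℝ (EuclideanSpace ℝ (Fin n)) :=
  Submodule.span ℝ (range fun i => Φ (z + σ • ξ i) - Φ z)

/-- The deviation `‖P_T^⊥ P_{S_k}‖₂`. -/
def secantDeviation {n k : ℕ} (M : Set (EuclideanSpace ℝ (Fin n)))
    (Φ : EuclideanSpace ℝ (Fin n) → EuclideanSpace ℝ (Fin n)) (z : EuclideanSpace ℝ (Fin n))
    (σ : ℝ) (ξ : Fin k → EuclideanSpace ℝ (Fin n)) : ℝ :=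
  ‖((footTangent M Φ z)ᗮ.starProjection).comp (secantSpan Φ z σ ξ).starProjection‖

/-- The second-order matrix `R = [R₁, …, R_k]`, `R_i = (σ² / 2) D²Φ(z)[ξ_i, ξ_i]`. -/
def secondOrderMatrix {n k : ℕ} (Φ : EuclideanSpace ℝ (Fin n) → EuclideanSpace ℝ (Fin n))
    (z : EuclideanSpace ℝ (Fin n)) (σ : ℝ) (ξ : Fin k → EuclideanSpace ℝ (Fin n)) :
    EuclideanSpace ℝ (Fin k) →L[ℝ] EuclideanSpace ℝ (Fin n) :=
  colMatrix fun i => (σ ^ 2 / 2) • iteratedFDeriv ℝ 2 Φ z ![ξ i, ξ i]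

/-- A manifold with a tube of radius `ρ`, a probability-flow map into the tube and a base point `z`.
The map is `C³` on the ball of radius `r` around `z`, with second and third derivatives at most `B`
there. -/
structure IsTubeFlow {n : ℕ} (d : ℕ) (M : Set (EuclideanSpace ℝ (Fin n))) (κ ρ : ℝ)
    (Φ : EuclideanSpace ℝ (Fin n) → EuclideanSpace ℝ (Fin n)) (z : EuclideanSpace ℝ (Fin n))
    (r B : ℝ) : Prop where
  submanifold : IsSmoothSubmanifold d M
  curvature : HasCurvatureBound M κ
  radius_pos : 0 < ρ
  radius_lt_reach : ENNReal.ofReal ρ < reach M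
  flow : IsProbabilityFlowMap Φ
  mapsTo_tube : ∀ w, Φ w ∈ Metric.cthickening ρ M
  contDiffOn : ContDiffOn ℝ 3 Φ (Metric.ball z r)
  second_deriv_le : ∀ w ∈ Metric.ball z r, ‖iteratedFDeriv ℝ 2 Φ w‖ ≤ B
  third_deriv_le : ∀ w ∈ Metric.ball z r, ‖iteratedFDeriv ℝ 3 Φ w‖ ≤ B

/-- Near-tangency of the differential, `‖P_T^⊥ DΦ(z)‖₂ ≤ L_⊥ ρ`, and curvature control of the normal
second-order deviation, `‖P_T^⊥ R‖₂ ≤ C_curv κ σ² ‖Ξ‖₂²`. -/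
structure IsNearTangent {n k : ℕ} (M : Set (EuclideanSpace ℝ (Fin n))) (κ ρ : ℝ)
    (Φ : EuclideanSpace ℝ (Fin n) → EuclideanSpace ℝ (Fin n)) (z : EuclideanSpace ℝ (Fin n))
    (σ : ℝ) (ξ : Fin k → EuclideanSpace ℝ (Fin n)) (Lperp Ccurv : ℝ) : Prop where
  differential : ‖((footTangent M Φ z)ᗮ.starProjection).comp (fderiv ℝ Φ z)‖ ≤ Lperp * ρ
  second_order : ‖((footTangent M Φ z)ᗮ.starProjection).comp (secondOrderMatrix Φ z σ ξ)‖ ≤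
    Ccurv * κ * σ ^ 2 * ‖colMatrix ξ‖ ^ 2

end

/-!
Write `Ξ = [ξ₁, …, ξ_k]` and `s = σ_min(DΠ(z) Ξ)`. By Federer's estimate the nearest-point
projection is Lipschitz on the `ρ`-tube with constant `1 / (1 - ρ / τ)`. Differentiating `Π = π ∘ Φ`
at `z` therefore gives `‖DΦ(z) Ξ a‖ ≥ (1 - ρ / τ) s ‖a‖`.

By Taylor's formula the matrix `V` of the secants is `σ DΦ(z) Ξ + R + O(σ³ ‖Ξ‖³)` with
`R = O(σ² ‖Ξ‖²)`. Hence `‖V a‖ ≥ (1 - δ) σ s ‖a‖` for some `δ = O(ρ + σ)`, while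
`‖P_T^⊥ V‖ ≤ σ (L_⊥ ρ ‖Ξ‖ + C_curv κ σ ‖Ξ‖² + O(σ² ‖Ξ‖³))`. As `V` maps onto `S_k`, the deviation
is at most the quotient of these two bounds. If `ρ ≤ Λ σ`, both the relative error `δ` and the
principal terms are `O(σ)`, so that their product is absorbed in the last term.
-/

section NearestPoint

open Metric

/-- `p` is a nearest point of `M` to `x`. -/
def IsNearest {X : Type*} [PseudoMetricSpace X] (M : Set X) (x p : X) : Prop :=
  p ∈ M ∧ dist x p = infDist x M

/-- Every point at distance less than `T` from `M` has at most one nearest point in `M`; this is the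
part of the condition `T ≤ reach M` on which Federer's estimates rest. -/
def HasUniqueNearest {X : Type*} [PseudoMetricSpace X] (M : Set X) (T : ℝ) : Prop :=
  ∀ ⦃x p q : X⦄, infDist x M < T → IsNearest M x p → IsNearest M x q → p = q

theorem IsNearest.of_dist_add_dist_eq {X : Type*} [PseudoMetricSpace X] {M : Set X} {x y p : X}
    (hp : IsNearest M x p) (hy : dist x y + dist y p = dist x p) : IsNearest M y p := by
  refine ⟨hp.1, le_antisymm ?_ (infDist_le_dist_of_mem hp.1)⟩
  have := infDist_le_infDist_add_dist (s := M) (x := x) (y := y)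
  linarith [hp.2]

theorem tendsto_of_isNearest {X ι : Type*} [MetricSpace X] [ProperSpace X] {M : Set X}
    (hM : IsClosed M) {l : Filter ι} {x q : ι → X} {y p : X} (hx : Tendsto x l (𝓝 y))
    (hq : ∀ i, IsNearest M (x i) (q i)) (hp : ∀ a, IsNearest M y a → a = p) :
    Tendsto q l (𝓝 p) := by
  have hdist : Tendsto (fun i => dist (x i) (q i)) l (𝓝 (infDist y M)) := by
    simp only [(hq _).2]
    exact ((continuous_infDist_pt M).tendsto y).comp hx
  refine (isCompact_closedBall y (infDist y M + 2)).tendsto_nhds_of_unique_mapClusterPt ?_ ?_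
  · filter_upwards [hdist.eventually_lt_const (lt_add_one _),
      hx.eventually (ball_mem_nhds y one_pos)] with i hqi hxi
    rw [mem_closedBall]
    linarith [dist_triangle_left (q i) y (x i)]
  · intro b _ hb
    obtain ⟨U, hU, hqU⟩ := mapClusterPt_iff_ultrafilter.1 hb
    exact hp b ⟨hM.mem_of_tendsto hqU (.of_forall fun i => (hq i).1),
      tendsto_nhds_unique ((hx.mono_left hU).dist hqU) (hdist.mono_left hU)⟩

variable {E : Type*} [NormedAddCommGroup E] [InnerProductSpace ℝ E] {M : Set E}

theorem IsNearest.two_mul_inner_le {x a b : E} (ha : IsNearest M x a) (hb : b ∈ M) :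
    2 * inner ℝ (x - a) (b - a) ≤ ‖b - a‖ ^ 2 := by
  have hle : ‖x - a‖ ≤ ‖(x - a) - (b - a)‖ := by
    rw [sub_sub_sub_cancel_right, ← dist_eq_norm, ← dist_eq_norm, ha.2]
    exact infDist_le_dist_of_mem hb
  have hsq : ‖x - a‖ ^ 2 ≤ ‖(x - a) - (b - a)‖ ^ 2 := by gcongr
  rw [norm_sub_sq_real (x - a)] at hsq
  linarith

variable [ProperSpace E]

theorem inner_sub_nonpos_of_isMaxOn_infDist (hM : IsClosed M) {C : Set E} (hC : Convex ℝ C)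
    {x y p : E} (hx : x ∈ C) (hy : y ∈ C) (hmax : IsMaxOn (infDist · M) C y)
    (hp : IsNearest M y p) (huniq : ∀ q, IsNearest M y q → q = p) :
    inner ℝ (x - y) (y - p) ≤ 0 := by
  choose q hqM hq using fun w : E => hM.exists_infDist_eq_dist ⟨p, hp.1⟩ w
  have hline : Tendsto (fun h : ℝ => y + h • (x - y)) (𝓝[>] 0) (𝓝 y) :=
    ((by fun_prop : Continuous fun h : ℝ => y + h • (x - y)).tendsto' 0 y (by simp)).mono_left
      nhdsWithin_le_nhds
  have hlim := tendsto_of_isNearest hM hline (fun h => ⟨hqM _, (hq _).symm⟩) huniq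
  refine le_of_tendsto (tendsto_const_nhds.inner (tendsto_const_nhds.sub hlim)) ?_
  filter_upwards [Ioc_mem_nhdsGT one_pos] with h ⟨hpos, hle⟩
  set b := q (y + h • (x - y))
  have hnorm : ‖y - b + h • (x - y)‖ ≤ ‖y - b‖ := by
    rw [sub_add_eq_add_sub, ← dist_eq_norm, ← dist_eq_norm, ← hq]
    exact (hmax (hC.add_smul_sub_mem hy hx ⟨hpos.le, hle⟩)).trans (infDist_le_dist_of_mem (hqM _))
  have hsq : ‖y - b + h • (x - y)‖ ^ 2 ≤ ‖y - b‖ ^ 2 := by gcongr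
  rw [norm_add_sq_real, inner_smul_right, real_inner_comm] at hsq
  exact nonpos_of_mul_nonpos_right (by linarith [sq_nonneg ‖h • (x - y)‖]) hpos

theorem mul_norm_sub_le_inner_of_isMaxOn_closedBall (hM : IsClosed M) {x y p : E} {s : ℝ}
    (hy : y ∈ closedBall x s) (hmax : IsMaxOn (infDist · M) (closedBall x s) y)
    (hp : IsNearest M y p) (huniq : ∀ q, IsNearest M y q → q = p) :
    s * ‖y - p‖ ≤ inner ℝ (y - x) (y - p) := by
  have hs : 0 ≤ s := dist_nonneg.trans hy
  rcases eq_or_ne (y - p) 0 with hw | hw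
  · simp [hw]
  have hw' : ‖y - p‖ ≠ 0 := norm_ne_zero_iff.2 hw
  have hmem : x + (s / ‖y - p‖) • (y - p) ∈ closedBall x s := by
    rw [mem_closedBall, dist_self_add_left, norm_smul, norm_div, norm_norm,
      div_mul_cancel₀ _ hw', Real.norm_of_nonneg hs]
  have h := inner_sub_nonpos_of_isMaxOn_infDist hM (convex_closedBall x s) hmem hy hmax hp huniq
  rw [add_sub_right_comm, ← neg_sub y x, inner_add_left, inner_neg_left, inner_smul_left,
    real_inner_self_eq_norm_sq, conj_trivial, sq, ← mul_assoc, div_mul_cancel₀ _ hw'] at h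
  linarith

/-- The reflected point is where `infDist · M` is maximal on the closed ball of radius `dist x a`
around `x`. -/
theorem HasUniqueNearest.isNearest_reflect {T : ℝ} (hT : HasUniqueNearest M T) (hM : IsClosed M)
    {x a : E} (ha : IsNearest M x a) (hxT : 2 * dist x a < T) :
    IsNearest M (x + (x - a)) a := by
  obtain ⟨y, hy, hmax⟩ := (isCompact_closedBall x (dist x a)).exists_isMaxOn
    ⟨x, mem_closedBall_self dist_nonneg⟩ (continuous_infDist_pt M).continuousOn
  have hyx : dist y x ≤ dist x a := hy
  obtain ⟨p, hpM, hpy⟩ := hM.exists_infDist_eq_dist ⟨a, ha.1⟩ y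
  have hp : IsNearest M y p := ⟨hpM, hpy.symm⟩
  have hxp : dist x a ≤ dist x p := ha.2.trans_le (infDist_le_dist_of_mem hpM)
  have hyp_le : dist y p ≤ 2 * dist x a := by
    have := infDist_le_infDist_add_dist (s := M) (x := y) (y := x)
    linarith [ha.2]
  have hle_yp : dist x a ≤ dist y p := by
    rw [ha.2, hp.2]
    exact hmax (mem_closedBall_self dist_nonneg)
  have hinner := mul_norm_sub_le_inner_of_isMaxOn_closedBall hM hy hmax hp
    fun q hq => hT (by linarith) hq hp
  have hxp_le : dist x p ≤ dist y p - dist x a := by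
    have hsq : ‖y - x‖ ^ 2 ≤ dist x a ^ 2 := by rw [← dist_eq_norm]; gcongr
    refine le_of_sq_le_sq ?_ (sub_nonneg.2 hle_yp)
    calc dist x p ^ 2 = ‖y - p‖ ^ 2 - 2 * inner ℝ (y - x) (y - p) + ‖y - x‖ ^ 2 := by
          rw [real_inner_comm, ← norm_sub_sq_real, sub_sub_sub_cancel_left, dist_eq_norm]
      _ ≤ ‖y - p‖ ^ 2 - 2 * (dist x a * ‖y - p‖) + dist x a ^ 2 := by gcongr
      _ = (dist y p - dist x a) ^ 2 := by rw [dist_eq_norm y p]; ring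
  obtain rfl : p = a := hT (by linarith [ha.2, dist_nonneg (x := x) (y := a)])
    ⟨hpM, by linarith [ha.2]⟩ ha
  have hreflect : y - x = x - p := by
    apply eq_of_norm_eq_of_norm_add_eq <;>
      simp only [sub_add_sub_cancel, ← dist_eq_norm] <;> linarith [dist_triangle y x p]
  rwa [← hreflect, add_sub_cancel]

theorem HasUniqueNearest.isNearest_ray {T : ℝ} (hT : HasUniqueNearest M T) (hM : IsClosed M)
    {a v : E} (hv : IsNearest M (a + v) a) {t : ℝ} (ht : 0 ≤ t) (htT : t * ‖v‖ < T) :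
    IsNearest M (a + t • v) a := by
  have hdouble : ∀ m : ℕ, ∀ t : ℝ, 0 ≤ t → t ≤ 2 ^ m → t * ‖v‖ < T →
      IsNearest M (a + t • v) a := by
    intro m
    induction m with
    | zero =>
      intro t ht hle _
      refine hv.of_dist_add_dist_eq ?_
      rw [pow_zero] at hle
      rw [dist_add_left, dist_self_add_left, dist_self_add_left, dist_eq_norm,
        show v - t • v = (1 - t) • v by module, norm_smul_of_nonneg (sub_nonneg.2 hle),
        norm_smul_of_nonneg ht]
      ring
    | succ m ih =>
      intro t ht hle hlt
      have hhalf := ih (t / 2) (by linarith) (by rw [pow_succ] at hle; linarith)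
        (by linarith [mul_nonneg ht (norm_nonneg v)])
      have := hT.isNearest_reflect hM hhalf (by
        rw [dist_self_add_left, norm_smul_of_nonneg (by linarith)]; linarith)
      convert this using 1
      module
  obtain ⟨m, hm⟩ := pow_unbounded_of_one_lt t one_lt_two
  exact hdouble m t ht hm.le htT

theorem HasUniqueNearest.two_mul_inner_le {T : ℝ} (hT : HasUniqueNearest M T) (hM : IsClosed M)
    (hT0 : 0 < T) {x a b : E} (ha : IsNearest M x a) (hb : b ∈ M) :
    2 * T * inner ℝ (x - a) (b - a) ≤ ‖x - a‖ * ‖b - a‖ ^ 2 := by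
  rcases eq_or_ne x a with rfl | hne
  · simp
  have hpos : 0 < ‖x - a‖ := norm_pos_iff.2 (sub_ne_zero.2 hne)
  have hlt : Ico 0 T ⊆ {s | 2 * s * inner ℝ (x - a) (b - a) ≤ ‖x - a‖ * ‖b - a‖ ^ 2} := by
    intro s ⟨hs0, hsT⟩
    have hray := (hT.isNearest_ray hM (v := x - a) (by rwa [add_sub_cancel])
      (div_nonneg hs0 hpos.le) (by rwa [div_mul_cancel₀ _ hpos.ne'])).two_mul_inner_le hb
    rw [add_sub_cancel_left, inner_smul_left, conj_trivial] at hray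
    calc 2 * s * inner ℝ (x - a) (b - a)
        = ‖x - a‖ * (2 * (s / ‖x - a‖ * inner ℝ (x - a) (b - a))) := by field_simp
      _ ≤ ‖x - a‖ * ‖b - a‖ ^ 2 := by gcongr
  have hcl := (isClosed_le (by fun_prop) continuous_const).closure_subset_iff.2 hlt
  rw [closure_Ico hT0.ne] at hcl
  exact hcl (right_mem_Icc.2 hT0.le)

theorem HasUniqueNearest.one_sub_div_mul_norm_le {T ρ : ℝ} (hT : HasUniqueNearest M T)
    (hM : IsClosed M) (hT0 : 0 < T) {x y a b : E} (ha : IsNearest M x a) (hb : IsNearest M y b)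
    (hx : infDist x M ≤ ρ) (hy : infDist y M ≤ ρ) : (1 - ρ / T) * ‖b - a‖ ≤ ‖y - x‖ := by
  rcases eq_or_ne b a with rfl | hne
  · simp
  have hnormal : ∀ {x a b : E}, IsNearest M x a → b ∈ M → infDist x M ≤ ρ →
      inner ℝ (x - a) (b - a) ≤ ρ / (2 * T) * ‖b - a‖ ^ 2 := by
    intro x a b ha hb hx
    rw [div_mul_eq_mul_div, le_div_iff₀ (by positivity), mul_comm]
    refine (hT.two_mul_inner_le hM hT0 ha hb).trans ?_
    rw [← dist_eq_norm, ha.2]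
    gcongr
  have hxa := hnormal ha hb.1 hx
  have hyb := hnormal hb ha.1 hy
  rw [← neg_sub b a, inner_neg_right, norm_neg] at hyb
  refine le_of_mul_le_mul_right ?_ (norm_pos_iff.2 (sub_ne_zero.2 hne))
  calc (1 - ρ / T) * ‖b - a‖ * ‖b - a‖
      = ‖b - a‖ ^ 2 - ρ / (2 * T) * ‖b - a‖ ^ 2 - ρ / (2 * T) * ‖b - a‖ ^ 2 := by
        field_simp; ring
    _ ≤ ‖b - a‖ ^ 2 + inner ℝ (y - b) (b - a) - inner ℝ (x - a) (b - a) := by linarith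
    _ = inner ℝ (y - x) (b - a) := by
        rw [← real_inner_self_eq_norm_sq, ← inner_add_left, ← inner_sub_left]
        congr 1
        abel
    _ ≤ ‖y - x‖ * ‖b - a‖ := real_inner_le_norm _ _

end NearestPoint

section Reach

variable {n : ℕ} {M : Set (EuclideanSpace ℝ (Fin n))} {τ : ℝ}

theorem isClosed_of_reach_pos (hM : 0 < reach M) : IsClosed M := by
  obtain ⟨R, hR, h0⟩ := lt_sSup_iff.1 hM
  refine isClosed_of_closure_subset fun x hx => ?_
  rw [Metric.mem_closure_iff_infEDist_zero] at hx
  obtain ⟨y, ⟨hy, hxy⟩, -⟩ := hR x (by rwa [hx])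
  rw [hx, edist_eq_zero] at hxy
  rwa [hxy]

theorem isNearest_iff_edist (x y : EuclideanSpace ℝ (Fin n)) :
    IsNearest M x y ↔ y ∈ M ∧ edist x y = Metric.infEDist x M := by
  refine and_congr_right fun hy => ?_
  rw [dist_edist, Metric.infDist,
    ENNReal.toReal_eq_toReal_iff' (edist_ne_top x y) (Metric.infEDist_ne_top ⟨y, hy⟩)]

theorem hasUniqueNearest_of_le_reach (hM : ENNReal.ofReal τ ≤ reach M) : HasUniqueNearest M τ := by
  intro x p q hx hp hq
  have hxM : Metric.infEDist x M < ENNReal.ofReal τ :=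
    (ENNReal.lt_ofReal_iff_toReal_lt (Metric.infEDist_ne_top ⟨p, hp.1⟩)).2 hx
  obtain ⟨R, hR, hxR⟩ := lt_sSup_iff.1 (hxM.trans_le hM)
  exact (hR x hxR).unique ((isNearest_iff_edist x p).1 hp) ((isNearest_iff_edist x q).1 hq)

theorem isNearest_nearestPoint (hM : IsClosed M) (hne : M.Nonempty)
    (x : EuclideanSpace ℝ (Fin n)) : IsNearest M x (nearestPoint M x) := by
  have h : ∃ y, y ∈ M ∧ edist x y = Metric.infEDist x M := by
    obtain ⟨y, hy, hxy⟩ := hM.exists_infDist_eq_dist hne x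
    exact ⟨y, (isNearest_iff_edist x y).1 ⟨hy, hxy.symm⟩⟩
  rw [isNearest_iff_edist, nearestPoint, dif_pos h]
  exact h.choose_spec

theorem one_sub_div_mul_norm_nearestPoint_sub_le (hM : ENNReal.ofReal τ ≤ reach M) (hτ : 0 < τ)
    {ρ : ℝ} (hρ : 0 ≤ ρ) {x y : EuclideanSpace ℝ (Fin n)} (hx : x ∈ Metric.cthickening ρ M)
    (hy : y ∈ Metric.cthickening ρ M) :
    (1 - ρ / τ) * ‖nearestPoint M y - nearestPoint M x‖ ≤ ‖y - x‖ := by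
  have hcl : IsClosed M := isClosed_of_reach_pos ((ENNReal.ofReal_pos.2 hτ).trans_le hM)
  have hne : M.Nonempty := by
    by_contra! h
    rwa [h, Metric.cthickening_empty] at hx
  have hle : ∀ w ∈ Metric.cthickening ρ M, Metric.infDist w M ≤ ρ := fun w hw =>
    ENNReal.toReal_le_of_le_ofReal hρ (Metric.mem_cthickening_iff.1 hw)
  exact (hasUniqueNearest_of_le_reach hM).one_sub_div_mul_norm_le hcl hτ
    (isNearest_nearestPoint hcl hne x) (isNearest_nearestPoint hcl hne y) (hle x hx) (hle y hy)

end Reach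

section Calculus

variable {E F G : Type*} [NormedAddCommGroup E] [NormedSpace ℝ E]
  [NormedAddCommGroup F] [NormedSpace ℝ F] [NormedAddCommGroup G] [NormedSpace ℝ G]

theorem norm_sub_taylor_le [CompleteSpace F] {f : E → F} {x y : E} {n : ℕ} {B : ℝ}
    (hf : ∀ t ∈ Icc (0 : ℝ) 1, ContDiffAt ℝ (n + 1) f (x + t • y))
    (hB : ∀ t ∈ Icc (0 : ℝ) 1, ‖iteratedFDeriv ℝ (n + 1) f (x + t • y)‖ ≤ B) :
    ‖f (x + y) - ∑ k ∈ Finset.range (n + 1),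
        (k.factorial : ℝ)⁻¹ • iteratedFDeriv ℝ k f x fun _ => y‖ ≤
      B * ‖y‖ ^ (n + 1) / n.factorial := by
  have hint : ∀ t ∈ uIoc (0 : ℝ) 1,
      ‖(1 - t) ^ n • iteratedFDeriv ℝ (n + 1) f (x + t • y) fun _ => y‖ ≤ B * ‖y‖ ^ (n + 1) := by
    intro t ht
    rw [uIoc_of_le zero_le_one] at ht
    have ht' : t ∈ Icc (0 : ℝ) 1 := ⟨ht.1.le, ht.2⟩
    rw [norm_smul_of_nonneg (pow_nonneg (sub_nonneg.2 ht.2) n)]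
    refine (mul_le_of_le_one_left (norm_nonneg _)
      (pow_le_one₀ (sub_nonneg.2 ht.2) (by linarith [ht.1]))).trans ?_
    simpa using ContinuousMultilinearMap.le_of_opNorm_le (hB t ht') fun _ => y
  rw [map_add_eq_sum_add_integral_iteratedFDeriv hf, add_sub_cancel_left, norm_smul, norm_inv,
    Real.norm_natCast, ← div_eq_inv_mul]
  gcongr
  simpa using intervalIntegral.norm_integral_le_of_norm_le_const hint

theorem norm_sub_taylor_two_le_of_ball [CompleteSpace F] {f : E → F} {z v : E} {r B : ℝ}
    (hf : ContDiffOn ℝ 3 f (Metric.ball z r))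
    (hB : ∀ w ∈ Metric.ball z r, ‖iteratedFDeriv ℝ 3 f w‖ ≤ B) (hv : ‖v‖ < r) :
    ‖f (z + v) - f z - fderiv ℝ f z v - (1 / 2 : ℝ) • iteratedFDeriv ℝ 2 f z ![v, v]‖ ≤
      B * ‖v‖ ^ 3 / 2 := by
  have hmem : ∀ t ∈ Icc (0 : ℝ) 1, z + t • v ∈ Metric.ball z r := fun t ht => by
    rw [Metric.mem_ball, dist_self_add_left, norm_smul_of_nonneg ht.1]
    exact (mul_le_of_le_one_left (norm_nonneg v) ht.2).trans_lt hv
  have h := norm_sub_taylor_le (n := 2)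
    (fun t ht => hf.contDiffAt (Metric.isOpen_ball.mem_nhds (hmem t ht)))
    fun t ht => hB _ (hmem t ht)
  simp only [Finset.sum_range_succ, Finset.sum_range_zero, iteratedFDeriv_zero_apply,
    iteratedFDeriv_one_apply, Nat.factorial_zero, Nat.factorial_one, Nat.factorial_two,
    Nat.cast_one, Nat.cast_ofNat, inv_one, one_smul, zero_add, ← sub_sub] at h
  rwa [one_div, show ![v, v] = fun _ => v by ext i; fin_cases i <;> rfl]

theorem mul_norm_fderiv_le {f : E → F} {g : E → G} {z : E} {c : ℝ}
    (hf : DifferentiableAt ℝ f z) (h : ∀ᶠ w in 𝓝 z, c * ‖g w - g z‖ ≤ ‖f w - f z‖) (v : E) :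
    c * ‖fderiv ℝ g z v‖ ≤ ‖fderiv ℝ f z v‖ := by
  by_cases hg : DifferentiableAt ℝ g z
  · have hf' := (hf.hasFDerivAt.hasLineDerivAt v).tendsto_slope_zero.norm
    have hg' := ((hg.hasFDerivAt.hasLineDerivAt v).tendsto_slope_zero.norm).const_mul c
    have hline : Tendsto (fun t : ℝ => z + t • v) (𝓝[≠] 0) (𝓝 z) :=
      ((by fun_prop : Continuous fun t : ℝ => z + t • v).tendsto' 0 z (by simp)).mono_left
        nhdsWithin_le_nhds
    refine le_of_tendsto_of_tendsto hg' hf' ?_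
    filter_upwards [hline.eventually h] with t ht
    rw [norm_smul, norm_smul, mul_left_comm]
    gcongr
  · simp [fderiv_zero_of_not_differentiableAt hg]

end Calculus

section Operator

variable {𝕜 E F G : Type*} [RCLike 𝕜] [NormedAddCommGroup E] [InnerProductSpace 𝕜 E]
  [NormedAddCommGroup F] [InnerProductSpace 𝕜 F] [NormedAddCommGroup G] [NormedSpace 𝕜 G]

theorem singularValues_finrank_sub_one_mul_norm_le [FiniteDimensional 𝕜 E]
    [FiniteDimensional 𝕜 F] (T : E →ₗ[𝕜] F) (x : E) :
    T.singularValues (Module.finrank 𝕜 E - 1) * ‖x‖ ≤ ‖T x‖ := by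
  have hsymm := T.isSymmetric_adjoint_comp_self
  let b := hsymm.eigenvectorBasis rfl
  have hTx : ‖T x‖ ^ 2 = ∑ i : Fin (Module.finrank 𝕜 E),
      T.singularValues i ^ 2 * ‖inner 𝕜 (b i) x‖ ^ 2 := by
    have hinner : (‖T x‖ ^ 2 : 𝕜) = inner 𝕜 x ((T.adjoint ∘ₗ T) x) := by
      rw [LinearMap.comp_apply, LinearMap.adjoint_inner_right, inner_self_eq_norm_sq_to_K]
    rw [← b.sum_inner_mul_inner] at hinner
    have hterm : ∀ i, inner 𝕜 x (b i) * inner 𝕜 (b i) ((T.adjoint ∘ₗ T) x) =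
        ((T.singularValues i ^ 2 * ‖inner 𝕜 (b i) x‖ ^ 2 : ℝ) : 𝕜) := fun i => by
      rw [← hsymm, hsymm.apply_eigenvectorBasis, inner_smul_left, RCLike.conj_ofReal,
        mul_left_comm, ← inner_conj_symm, RCLike.conj_mul, ← T.sq_singularValues_fin rfl]
      norm_cast
    simp only [hterm] at hinner
    exact_mod_cast hinner
  refine le_of_sq_le_sq ?_ (norm_nonneg _)
  rw [mul_pow, hTx, ← b.sum_sq_norm_inner_right x, Finset.mul_sum]
  refine Finset.sum_le_sum fun i _ => ?_
  gcongr
  · exact T.singularValues_nonneg _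
  · exact T.singularValues_antitone (by omega)

theorem norm_comp_starProjection_le_div {H : Type*} [NormedAddCommGroup H] [NormedSpace 𝕜 H]
    {S : Submodule 𝕜 F} [S.HasOrthogonalProjection] {V : G →L[𝕜] F} {P : F →L[𝕜] H} {m N : ℝ}
    (hS : (S : Set F) ⊆ range V) (hm : 0 < m) (hlow : ∀ a, m * ‖a‖ ≤ ‖V a‖)
    (hup : ‖P.comp V‖ ≤ N) : ‖P.comp S.starProjection‖ ≤ N / m := by
  have hN : 0 ≤ N := (norm_nonneg _).trans hup
  refine ContinuousLinearMap.opNorm_le_bound _ (by positivity) fun x => ?_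
  obtain ⟨a, ha⟩ := hS (S.starProjection_apply_mem x)
  have hax : ‖a‖ ≤ ‖x‖ / m := (le_div_iff₀' hm).2
    ((hlow a).trans (ha ▸ S.norm_starProjection_apply_le x))
  calc ‖P (S.starProjection x)‖ = ‖P.comp V a‖ := by rw [← ha, ContinuousLinearMap.comp_apply]
    _ ≤ N * ‖a‖ := ContinuousLinearMap.le_of_opNorm_le _ hup a
    _ ≤ N * (‖x‖ / m) := by gcongr
    _ = N / m * ‖x‖ := by ring

end Operator

section ColMatrix

variable {n k : ℕ}

theorem colMatrix_apply (v : Fin k → EuclideanSpace ℝ (Fin n)) (a : EuclideanSpace ℝ (Fin k)) :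
    colMatrix v a = ∑ i, a i • v i := by
  simp [colMatrix]

theorem norm_le_norm_colMatrix (v : Fin k → EuclideanSpace ℝ (Fin n)) (i : Fin k) :
    ‖v i‖ ≤ ‖colMatrix v‖ := by
  have := (colMatrix v).le_opNorm (EuclideanSpace.single i 1)
  simpa [colMatrix_apply, Pi.single_apply] using this

theorem norm_colMatrix_le {v : Fin k → EuclideanSpace ℝ (Fin n)} {C : ℝ} (hC : ∀ i, ‖v i‖ ≤ C) :
    ‖colMatrix v‖ ≤ k * C := by
  have hcol : ∀ i ∈ Finset.univ, ‖(EuclideanSpace.proj i :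
      EuclideanSpace ℝ (Fin k) →L[ℝ] ℝ).smulRight (v i)‖ ≤ C := fun i _ => by
    have hC0 : 0 ≤ C := (norm_nonneg _).trans (hC i)
    refine ContinuousLinearMap.opNorm_le_bound _ hC0 fun a => ?_
    rw [ContinuousLinearMap.smulRight_apply, norm_smul, mul_comm]
    gcongr
    · exact hC i
    · exact PiLp.norm_apply_le a i
  simpa only [colMatrix, Finset.sum_const, Finset.card_univ, Fintype.card_fin, nsmul_eq_mul] using
    (norm_sum_le _ _).trans (Finset.sum_le_sum hcol)

theorem range_colMatrix (v : Fin k → EuclideanSpace ℝ (Fin n)) :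
    range (colMatrix v) = Submodule.span ℝ (range v) := by
  ext x
  simp only [SetLike.mem_coe, Submodule.mem_span_range_iff_exists_fun, mem_range, colMatrix_apply]
  exact (WithLp.equiv 2 (Fin k → ℝ)).exists_congr_left

end ColMatrix

/-- What the estimates use of `IsTubeFlow`: `Φ` maps a ball around `z` into the tube of radius `ρ`
around a set `M` of normal curvature at most `κ`, with second derivative at `z` and third
derivatives on the ball bounded by `B`. -/
structure IsTubeMap {n : ℕ} (M : Set (EuclideanSpace ℝ (Fin n))) (κ ρ : ℝ)
    (Φ : EuclideanSpace ℝ (Fin n) → EuclideanSpace ℝ (Fin n)) (z : EuclideanSpace ℝ (Fin n))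
    (r B : ℝ) : Prop where
  curvature : HasCurvatureBound M κ
  radius_nonneg : 0 ≤ ρ
  mapsTo_tube : MapsTo Φ (Metric.ball z r) (Metric.cthickening ρ M)
  contDiffOn : ContDiffOn ℝ 3 Φ (Metric.ball z r)
  second_deriv_le : ‖iteratedFDeriv ℝ 2 Φ z‖ ≤ B
  third_deriv_le : ∀ w ∈ Metric.ball z r, ‖iteratedFDeriv ℝ 3 Φ w‖ ≤ B

/-- The `n × k` matrix `[Δ₁, …, Δ_k]` of secants `Δ_i = Φ(z + σ ξ_i) - Φ(z)`, whose columns span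
`secantSpan Φ z σ ξ`. -/
noncomputable def secantMatrix {n k : ℕ} (Φ : EuclideanSpace ℝ (Fin n) → EuclideanSpace ℝ (Fin n))
    (z : EuclideanSpace ℝ (Fin n)) (σ : ℝ) (ξ : Fin k → EuclideanSpace ℝ (Fin n)) :
    EuclideanSpace ℝ (Fin k) →L[ℝ] EuclideanSpace ℝ (Fin n) :=
  colMatrix fun i => Φ (z + σ • ξ i) - Φ z

section Deviation

variable {n k : ℕ} {M : Set (EuclideanSpace ℝ (Fin n))}
  {Φ : EuclideanSpace ℝ (Fin n) → EuclideanSpace ℝ (Fin n)} {z : EuclideanSpace ℝ (Fin n)}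
  {ξ : Fin k → EuclideanSpace ℝ (Fin n)} {κ ρ r B τ σ Lperp Ccurv s₀ : ℝ}

theorem IsTubeFlow.isTubeMap {d : ℕ} (h : IsTubeFlow d M κ ρ Φ z r B) (hr : 0 < r) :
    IsTubeMap M κ ρ Φ z r B where
  curvature := h.curvature
  radius_nonneg := h.radius_pos.le
  mapsTo_tube w _ := h.mapsTo_tube w
  contDiffOn := h.contDiffOn
  second_deriv_le := h.second_deriv_le z (Metric.mem_ball_self hr)
  third_deriv_le := h.third_deriv_le

theorem IsTubeMap.bound_nonneg (hΦ : IsTubeMap M κ ρ Φ z r B) : 0 ≤ B :=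
  (norm_nonneg _).trans hΦ.second_deriv_le

theorem tangentSignal_mul_norm_le (M : Set (EuclideanSpace ℝ (Fin n)))
    (Φ : EuclideanSpace ℝ (Fin n) → EuclideanSpace ℝ (Fin n)) (z : EuclideanSpace ℝ (Fin n))
    (ξ : Fin k → EuclideanSpace ℝ (Fin n)) (a : EuclideanSpace ℝ (Fin k)) :
    tangentSignal M Φ z ξ * ‖a‖ ≤ ‖fderiv ℝ (footMap M Φ) z (colMatrix ξ a)‖ := by
  have h := singularValues_finrank_sub_one_mul_norm_le
    ((fderiv ℝ (footMap M Φ) z).comp (colMatrix ξ)).toLinearMap a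
  rwa [finrank_euclideanSpace_fin] at h

theorem norm_colMatrix_pos_of_tangentSignal_pos (hk : 1 ≤ k) (hs : 0 < tangentSignal M Φ z ξ) :
    0 < ‖colMatrix ξ‖ := by
  refine norm_pos_iff.2 fun hξ => hs.not_ge ?_
  simpa [hξ] using tangentSignal_mul_norm_le M Φ z ξ (EuclideanSpace.single ⟨0, hk⟩ 1)

theorem norm_secondOrderMatrix_le (hB : ‖iteratedFDeriv ℝ 2 Φ z‖ ≤ B) :
    ‖secondOrderMatrix Φ z σ ξ‖ ≤ k * (σ ^ 2 / 2 * (B * ‖colMatrix ξ‖ ^ 2)) := by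
  have hB0 : 0 ≤ B := (norm_nonneg _).trans hB
  refine norm_colMatrix_le fun i => ?_
  rw [norm_smul_of_nonneg (by positivity)]
  gcongr
  refine (ContinuousMultilinearMap.le_of_opNorm_le hB _).trans ?_
  rw [Fin.prod_univ_two, sq]
  gcongr <;> exact norm_le_norm_colMatrix ξ i

theorem secantMatrix_sub_taylor (Φ : EuclideanSpace ℝ (Fin n) → EuclideanSpace ℝ (Fin n))
    (z : EuclideanSpace ℝ (Fin n)) (σ : ℝ) (ξ : Fin k → EuclideanSpace ℝ (Fin n)) :
    secantMatrix Φ z σ ξ - σ • (fderiv ℝ Φ z).comp (colMatrix ξ) - secondOrderMatrix Φ z σ ξ =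
      colMatrix fun i => Φ (z + σ • ξ i) - Φ z - fderiv ℝ Φ z (σ • ξ i) -
        (1 / 2 : ℝ) • iteratedFDeriv ℝ 2 Φ z ![σ • ξ i, σ • ξ i] := by
  have hquad : ∀ i, iteratedFDeriv ℝ 2 Φ z ![σ • ξ i, σ • ξ i] =
      σ ^ 2 • iteratedFDeriv ℝ 2 Φ z ![ξ i, ξ i] := fun i => by
    simp only [iteratedFDeriv_two_apply, Matrix.cons_val_zero, Matrix.cons_val_one, map_smul,
      _root_.smul_apply, smul_smul, sq]
  ext1 a
  simp only [_root_.sub_apply, _root_.smul_apply, ContinuousLinearMap.comp_apply, secantMatrix,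
    secondOrderMatrix, colMatrix_apply, map_sum, map_smul, Finset.smul_sum,
    ← Finset.sum_sub_distrib, hquad]
  refine Finset.sum_congr rfl fun i _ => ?_
  module

theorem norm_secantMatrix_sub_taylor_le (hΦ : IsTubeMap M κ ρ Φ z r B) (hσ : 0 ≤ σ)
    (hσr : σ * ‖colMatrix ξ‖ < r) :
    ‖secantMatrix Φ z σ ξ - σ • (fderiv ℝ Φ z).comp (colMatrix ξ) - secondOrderMatrix Φ z σ ξ‖ ≤
      k * (B * (σ * ‖colMatrix ξ‖) ^ 3 / 2) := by
  have hB := hΦ.bound_nonneg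
  rw [secantMatrix_sub_taylor]
  refine norm_colMatrix_le fun i => ?_
  have hle : ‖σ • ξ i‖ ≤ σ * ‖colMatrix ξ‖ := by
    rw [norm_smul_of_nonneg hσ]
    gcongr
    exact norm_le_norm_colMatrix ξ i
  refine (norm_sub_taylor_two_le_of_ball hΦ.contDiffOn hΦ.third_deriv_le
    (hle.trans_lt hσr)).trans ?_
  gcongr

theorem tangentSignal_mul_norm_le_norm_fderiv (hM : ENNReal.ofReal τ ≤ reach M) (hτ : 0 < τ)
    (hρτ : ρ ≤ τ) (hΦ : IsTubeMap M κ ρ Φ z r B) (hr : 0 < r) (a : EuclideanSpace ℝ (Fin k)) :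
    (1 - ρ / τ) * tangentSignal M Φ z ξ * ‖a‖ ≤ ‖fderiv ℝ Φ z (colMatrix ξ a)‖ := by
  have hball : Metric.ball z r ∈ 𝓝 z := Metric.ball_mem_nhds z hr
  have hdiff : DifferentiableAt ℝ Φ z :=
    (hΦ.contDiffOn.contDiffAt hball).differentiableAt (by norm_num)
  have hc : 0 ≤ 1 - ρ / τ := sub_nonneg.2 ((div_le_one hτ).2 hρτ)
  calc (1 - ρ / τ) * tangentSignal M Φ z ξ * ‖a‖
      = (1 - ρ / τ) * (tangentSignal M Φ z ξ * ‖a‖) := mul_assoc _ _ _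
    _ ≤ (1 - ρ / τ) * ‖fderiv ℝ (footMap M Φ) z (colMatrix ξ a)‖ := by
        gcongr
        exact tangentSignal_mul_norm_le M Φ z ξ a
    _ ≤ ‖fderiv ℝ Φ z (colMatrix ξ a)‖ := by
        refine mul_norm_fderiv_le hdiff ?_ _
        filter_upwards [hball] with w hw
        exact one_sub_div_mul_norm_nearestPoint_sub_le hM hτ hΦ.radius_nonneg
          (hΦ.mapsTo_tube (Metric.mem_ball_self hr)) (hΦ.mapsTo_tube hw)

theorem mul_norm_le_norm_secantMatrix (hM : ENNReal.ofReal τ ≤ reach M) (hτ : 0 < τ)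
    (hρτ : ρ ≤ τ) (hΦ : IsTubeMap M κ ρ Φ z r B) (hσ : 0 ≤ σ) (hr : 0 < r)
    (hσr : σ * ‖colMatrix ξ‖ < r) (a : EuclideanSpace ℝ (Fin k)) :
    σ * ((1 - ρ / τ) * tangentSignal M Φ z ξ -
      k * B * ‖colMatrix ξ‖ ^ 2 * (1 + σ * ‖colMatrix ξ‖) / 2 * σ) * ‖a‖ ≤
      ‖secantMatrix Φ z σ ξ a‖ := by
  set A := (fderiv ℝ Φ z).comp (colMatrix ξ)
  set R := secondOrderMatrix Φ z σ ξ
  set V := secantMatrix Φ z σ ξ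
  have hA : (1 - ρ / τ) * tangentSignal M Φ z ξ * ‖a‖ ≤ ‖A a‖ :=
    tangentSignal_mul_norm_le_norm_fderiv hM hτ hρτ hΦ hr a
  have hR : ‖R a‖ ≤ k * (σ ^ 2 / 2 * (B * ‖colMatrix ξ‖ ^ 2)) * ‖a‖ :=
    R.le_of_opNorm_le (norm_secondOrderMatrix_le hΦ.second_deriv_le) a
  have hrem : ‖(V - σ • A - R) a‖ ≤ k * (B * (σ * ‖colMatrix ξ‖) ^ 3 / 2) * ‖a‖ :=
    ContinuousLinearMap.le_of_opNorm_le _ (norm_secantMatrix_sub_taylor_le hΦ hσ hσr) a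
  have htri : σ * ‖A a‖ ≤ ‖V a‖ + ‖R a‖ + ‖(V - σ • A - R) a‖ := by
    rw [← norm_smul_of_nonneg hσ, show σ • A a = V a - R a - (V - σ • A - R) a by
      simp only [_root_.sub_apply, _root_.smul_apply]; abel]
    exact (norm_sub_le _ _).trans (by gcongr; exact norm_sub_le _ _)
  linear_combination σ * hA + hR + hrem + htri

theorem norm_comp_secantMatrix_le (hΦ : IsTubeMap M κ ρ Φ z r B)
    (hN : IsNearTangent M κ ρ Φ z σ ξ Lperp Ccurv) (hσ : 0 ≤ σ) (hσr : σ * ‖colMatrix ξ‖ < r) :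
    ‖(footTangent M Φ z)ᗮ.starProjection.comp (secantMatrix Φ z σ ξ)‖ ≤
      σ * (Lperp * ρ * ‖colMatrix ξ‖ + Ccurv * κ * σ * ‖colMatrix ξ‖ ^ 2 +
        k * B * σ ^ 2 * ‖colMatrix ξ‖ ^ 3 / 2) := by
  set P := (footTangent M Φ z)ᗮ.starProjection
  set A := (fderiv ℝ Φ z).comp (colMatrix ξ)
  set R := secondOrderMatrix Φ z σ ξ
  set V := secantMatrix Φ z σ ξ
  have hA : ‖P.comp A‖ ≤ Lperp * ρ * ‖colMatrix ξ‖ :=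
    ((P.comp (fderiv ℝ Φ z)).opNorm_comp_le (colMatrix ξ)).trans (by gcongr; exact hN.differential)
  have hrem : ‖P.comp (V - σ • A - R)‖ ≤ k * (B * (σ * ‖colMatrix ξ‖) ^ 3 / 2) :=
    (P.opNorm_comp_le _).trans ((mul_le_of_le_one_left (norm_nonneg _)
      (Submodule.starProjection_norm_le _)).trans (norm_secantMatrix_sub_taylor_le hΦ hσ hσr))
  calc ‖P.comp V‖ = ‖σ • P.comp A + P.comp R + P.comp (V - σ • A - R)‖ := by
        rw [← ContinuousLinearMap.comp_smul, ← ContinuousLinearMap.comp_add,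
          ← ContinuousLinearMap.comp_add]
        congr 2
        abel
    _ ≤ σ * ‖P.comp A‖ + ‖P.comp R‖ + ‖P.comp (V - σ • A - R)‖ := by
        rw [← norm_smul_of_nonneg hσ]
        exact norm_add₃_le
    _ ≤ σ * (Lperp * ρ * ‖colMatrix ξ‖) + Ccurv * κ * σ ^ 2 * ‖colMatrix ξ‖ ^ 2 +
          k * (B * (σ * ‖colMatrix ξ‖) ^ 3 / 2) := by
        gcongr
        exact hN.second_order
    _ = _ := by ring

theorem secantDeviation_le_div (hM : ENNReal.ofReal τ ≤ reach M) (hτ : 0 < τ) (hρτ : ρ ≤ τ)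
    (hΦ : IsTubeMap M κ ρ Φ z r B) (hN : IsNearTangent M κ ρ Φ z σ ξ Lperp Ccurv)
    (hσ : 0 < σ) (hr : 0 < r) (hσr : σ * ‖colMatrix ξ‖ < r) {m : ℝ} (hm : 0 < m)
    (hle : m ≤ (1 - ρ / τ) * tangentSignal M Φ z ξ -
      k * B * ‖colMatrix ξ‖ ^ 2 * (1 + σ * ‖colMatrix ξ‖) / 2 * σ) :
    secantDeviation M Φ z σ ξ ≤ (Lperp * ρ * ‖colMatrix ξ‖ + Ccurv * κ * σ * ‖colMatrix ξ‖ ^ 2 +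
      k * B * σ ^ 2 * ‖colMatrix ξ‖ ^ 3 / 2) / m := by
  rw [← mul_div_mul_left _ m hσ.ne']
  refine norm_comp_starProjection_le_div (V := secantMatrix Φ z σ ξ) (range_colMatrix _).ge
    (mul_pos hσ hm) (fun a => ?_) (norm_comp_secantMatrix_le hΦ hN hσ.le hσr)
  refine le_trans ?_ (mul_norm_le_norm_secantMatrix hM hτ hρτ hΦ hσ.le hr hσr a)
  gcongr

theorem IsNearTangent.principal_nonneg (hN : IsNearTangent M κ ρ Φ z σ ξ Lperp Ccurv)
    (hσ : 0 < σ) :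
    0 ≤ Lperp * ρ * ‖colMatrix ξ‖ + Ccurv * κ * σ * ‖colMatrix ξ‖ ^ 2 := by
  have hL : 0 ≤ Lperp * ρ := (norm_nonneg _).trans hN.differential
  have hC : 0 ≤ σ * (Ccurv * κ * σ * ‖colMatrix ξ‖ ^ 2) := by
    linear_combination (norm_nonneg _).trans hN.second_order
  exact add_nonneg (mul_nonneg hL (norm_nonneg _)) (nonneg_of_mul_nonneg_right hC hσ)

theorem secantDeviation_le_one_add_two_mul (hM : ENNReal.ofReal τ ≤ reach M) (hτ : 0 < τ)
    (hΦ : IsTubeMap M κ ρ Φ z r B) (hN : IsNearTangent M κ ρ Φ z σ ξ Lperp Ccurv)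
    (hσ : 0 < σ) (hr : 0 < r) (hσr : σ * ‖colMatrix ξ‖ < r) (hs₀ : 0 < s₀)
    (hs : s₀ ≤ tangentSignal M Φ z ξ) {δ : ℝ} (hδ : δ ≤ 1 / 2)
    (hle : ρ / τ + k * B * ‖colMatrix ξ‖ ^ 2 * (1 + r) / (2 * s₀) * σ ≤ δ) :
    secantDeviation M Φ z σ ξ ≤
      (1 + 2 * δ) * (Lperp * ρ * ‖colMatrix ξ‖ / tangentSignal M Φ z ξ +
        Ccurv * κ * σ * ‖colMatrix ξ‖ ^ 2 / tangentSignal M Φ z ξ) +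
      k * B * σ ^ 2 * ‖colMatrix ξ‖ ^ 3 / tangentSignal M Φ z ξ := by
  have hB := hΦ.bound_nonneg
  have hρ := hΦ.radius_nonneg
  have hs0 : 0 < tangentSignal M Φ z ξ := hs₀.trans_le hs
  have hδ0 : 0 ≤ δ := le_trans (by positivity) hle
  have hρτ : ρ ≤ τ := by
    have : 0 ≤ k * B * ‖colMatrix ξ‖ ^ 2 * (1 + r) / (2 * s₀) * σ := by positivity
    rw [← div_le_one hτ]
    linarith
  have hcurv : k * B * ‖colMatrix ξ‖ ^ 2 * (1 + σ * ‖colMatrix ξ‖) / 2 * σ ≤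
      k * B * ‖colMatrix ξ‖ ^ 2 * (1 + r) / (2 * s₀) * σ * tangentSignal M Φ z ξ :=
    calc _ ≤ k * B * ‖colMatrix ξ‖ ^ 2 * (1 + r) / 2 * σ := by gcongr
      _ = k * B * ‖colMatrix ξ‖ ^ 2 * (1 + r) / (2 * s₀) * σ * s₀ := by field_simp
      _ ≤ _ := by gcongr
  have hdev := secantDeviation_le_div hM hτ hρτ hΦ hN hσ hr hσr
    (m := (1 - δ) * tangentSignal M Φ z ξ) (mul_pos (by linarith) hs0)
    (by linear_combination tangentSignal M Φ z ξ * hle + hcurv)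
  set T := Lperp * ρ * ‖colMatrix ξ‖ + Ccurv * κ * σ * ‖colMatrix ξ‖ ^ 2
  have hT : 0 ≤ T := hN.principal_nonneg hσ
  have hinv : (1 - δ)⁻¹ ≤ 1 + 2 * δ := by
    rw [inv_le_iff_one_le_mul₀ (by linarith)]
    nlinarith
  calc secantDeviation M Φ z σ ξ
      ≤ (1 - δ)⁻¹ * ((T + k * B * σ ^ 2 * ‖colMatrix ξ‖ ^ 3 / 2) / tangentSignal M Φ z ξ) := by
        rwa [← div_eq_inv_mul, div_div, mul_comm _ (1 - δ)]
    _ ≤ (1 + 2 * δ) * ((T + k * B * σ ^ 2 * ‖colMatrix ξ‖ ^ 3 / 2) / tangentSignal M Φ z ξ) := by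
        gcongr
    _ = (1 + 2 * δ) * (T / tangentSignal M Φ z ξ) + (1 + 2 * δ) / 2 *
          (k * B * σ ^ 2 * ‖colMatrix ξ‖ ^ 3 / tangentSignal M Φ z ξ) := by ring
    _ ≤ (1 + 2 * δ) * (T / tangentSignal M Φ z ξ) +
          k * B * σ ^ 2 * ‖colMatrix ξ‖ ^ 3 / tangentSignal M Φ z ξ := by
        gcongr
        exact mul_le_of_le_one_left (by positivity) (by linarith)
    _ = _ := by rw [add_div]

end Deviation

section Asymptotics

variable {n k : ℕ} {M : Set (EuclideanSpace ℝ (Fin n))}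
  {Φ : EuclideanSpace ℝ (Fin n) → EuclideanSpace ℝ (Fin n)} {z : EuclideanSpace ℝ (Fin n)}
  {ξ : Fin k → EuclideanSpace ℝ (Fin n)} {κ ρ r B τ σ Lperp Ccurv s₀ : ℝ}

theorem exists_pos_forall_mul_lt_and_mul_lt (X K : ℝ) {r δ : ℝ} (hr : 0 < r) (hδ : 0 < δ) :
    ∃ σ₀ > 0, ∀ σ, 0 < σ → σ ≤ σ₀ → σ * X < r ∧ K * σ < δ := by
  have hX : ∀ᶠ σ : ℝ in 𝓝 0, σ * X < r :=
    ((by fun_prop : Continuous fun σ : ℝ => σ * X).tendsto' 0 0 (zero_mul X)).eventually_lt_const hr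
  have hK : ∀ᶠ σ : ℝ in 𝓝 0, K * σ < δ :=
    ((by fun_prop : Continuous fun σ : ℝ => K * σ).tendsto' 0 0 (mul_zero K)).eventually_lt_const hδ
  obtain ⟨σ₀, hσ₀, hsub⟩ :=
    mem_nhdsGT_iff_exists_Ioc_subset.1 (nhdsWithin_le_nhds (s := Ioi 0) (hX.and hK))
  exact ⟨σ₀, hσ₀, fun σ hσ hσle => hsub ⟨hσ, hσle⟩⟩

theorem exists_secantDeviation_le (B : ℝ) (ξ : Fin k → EuclideanSpace ℝ (Fin n)) (hτ : 0 < τ)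
    (hr : 0 < r) (hs₀ : 0 < s₀) {ε : ℝ} (hε : 0 < ε) :
    ∃ σ₀ > 0, ∃ ρ₀ > 0, ∀ (M : Set (EuclideanSpace ℝ (Fin n)))
      (Φ : EuclideanSpace ℝ (Fin n) → EuclideanSpace ℝ (Fin n)) (z : EuclideanSpace ℝ (Fin n))
      (κ Lperp Ccurv σ ρ : ℝ), 0 < σ → σ ≤ σ₀ → ρ ≤ ρ₀ → ENNReal.ofReal τ ≤ reach M →
      IsTubeMap M κ ρ Φ z r B → IsNearTangent M κ ρ Φ z σ ξ Lperp Ccurv →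
      s₀ ≤ tangentSignal M Φ z ξ →
      secantDeviation M Φ z σ ξ ≤
        (1 + ε) * (Lperp * ρ * ‖colMatrix ξ‖ / tangentSignal M Φ z ξ +
          Ccurv * κ * σ * ‖colMatrix ξ‖ ^ 2 / tangentSignal M Φ z ξ) +
        k * B * σ ^ 2 * ‖colMatrix ξ‖ ^ 3 / tangentSignal M Φ z ξ := by
  set δ := min ε 1 / 2
  have hδ : 0 < δ := half_pos (lt_min hε one_pos)
  have hδε : 2 * δ ≤ ε := (mul_div_cancel₀ _ two_ne_zero).trans_le (min_le_left _ _)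
  have hδ1 : 2 * δ ≤ 1 := (mul_div_cancel₀ _ two_ne_zero).trans_le (min_le_right _ _)
  obtain ⟨σ₀, hσ₀, hsmall⟩ := exists_pos_forall_mul_lt_and_mul_lt ‖colMatrix ξ‖
    (k * B * ‖colMatrix ξ‖ ^ 2 * (1 + r) / (2 * s₀)) hr (half_pos hδ)
  refine ⟨σ₀, hσ₀, δ / 2 * τ, by positivity,
    fun M Φ z κ Lperp Ccurv σ ρ hσ hσle hρ hM hΦ hN hs => ?_⟩
  obtain ⟨hσr, hσδ⟩ := hsmall σ hσ hσle
  have hρδ : ρ / τ ≤ δ / 2 := (div_le_iff₀ hτ).2 hρ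
  have hT : 0 ≤ Lperp * ρ * ‖colMatrix ξ‖ / tangentSignal M Φ z ξ +
      Ccurv * κ * σ * ‖colMatrix ξ‖ ^ 2 / tangentSignal M Φ z ξ := by
    rw [← add_div]
    exact div_nonneg (hN.principal_nonneg hσ) (hs₀.le.trans hs)
  refine (secantDeviation_le_one_add_two_mul (δ := δ) hM hτ hΦ hN hσ hr hσr hs₀ hs (by linarith)
    (by linarith)).trans ?_
  gcongr

theorem principal_le_abs_mul (hρ : 0 ≤ ρ) (hκ : 0 ≤ κ) (hσ : 0 ≤ σ) {X s ρ₁ κ₁ : ℝ} (hX : 0 ≤ X)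
    (hs₀ : 0 < s₀) (hs : s₀ ≤ s) (hρ₁ : ρ ≤ ρ₁) (hκ₁ : κ ≤ κ₁) :
    Lperp * ρ * X / s + Ccurv * κ * σ * X ^ 2 / s ≤
      (|Lperp| * ρ₁ * X + |Ccurv| * κ₁ * σ * X ^ 2) / s₀ := by
  rw [← add_div]
  have : 0 ≤ κ₁ := hκ.trans hκ₁
  have : 0 ≤ ρ₁ := hρ.trans hρ₁
  gcongr <;> exact le_abs_self _

theorem exists_secantDeviation_le_of_radius_le_of_curvature_le (B : ℝ)
    (ξ : Fin k → EuclideanSpace ℝ (Fin n)) (hτ : 0 < τ) (hr : 0 < r) (hs₀ : 0 < s₀) :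
    ∃ σ₀ > 0, ∀ σ Lperp Ccurv η : ℝ, 0 < σ → σ ≤ σ₀ → 0 < η → ∃ δ > 0,
      ∀ (M : Set (EuclideanSpace ℝ (Fin n)))
        (Φ : EuclideanSpace ℝ (Fin n) → EuclideanSpace ℝ (Fin n)) (z : EuclideanSpace ℝ (Fin n))
        (κ ρ : ℝ), ρ ≤ δ → κ ≤ δ → ENNReal.ofReal τ ≤ reach M → IsTubeMap M κ ρ Φ z r B →
        IsNearTangent M κ ρ Φ z σ ξ Lperp Ccurv → s₀ ≤ tangentSignal M Φ z ξ →
        secantDeviation M Φ z σ ξ ≤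
          k * B * σ ^ 2 * ‖colMatrix ξ‖ ^ 3 / tangentSignal M Φ z ξ + η := by
  obtain ⟨σ₀, hσ₀, ρ₀, hρ₀, h⟩ := exists_secantDeviation_le B ξ hτ hr hs₀ one_pos
  refine ⟨σ₀, hσ₀, fun σ Lperp Ccurv η hσ hσle hη => ?_⟩
  obtain ⟨δ, hδ, hδη⟩ := exists_pos_mul_lt hη
    (2 * ((|Lperp| * ‖colMatrix ξ‖ + |Ccurv| * σ * ‖colMatrix ξ‖ ^ 2) / s₀))
  refine ⟨min δ ρ₀, lt_min hδ hρ₀, fun M Φ z κ ρ hρ hκ hM hΦ hN hs => ?_⟩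
  have hdev := h M Φ z κ Lperp Ccurv σ ρ hσ hσle (hρ.trans (min_le_right _ _)) hM hΦ hN hs
  have hprincipal := principal_le_abs_mul (Lperp := Lperp) (Ccurv := Ccurv) hΦ.radius_nonneg
    hΦ.curvature.1 hσ.le (norm_nonneg (colMatrix ξ)) hs₀ hs (hρ.trans (min_le_left _ _))
    (hκ.trans (min_le_left _ _))
  linear_combination hdev + 2 * hprincipal + hδη

theorem exists_secantDeviation_le_of_radius_le_mul (hk : 1 ≤ k) (hB : 0 ≤ B)
    (ξ : Fin k → EuclideanSpace ℝ (Fin n)) {Λ : ℝ} (hτ : 0 < τ) (hr : 0 < r) (hs₀ : 0 < s₀)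
    (hΛ : 0 ≤ Λ) :
    ∃ C₃ : ℝ, 0 ≤ C₃ ∧ ∃ σ₀ > 0, ∀ (M : Set (EuclideanSpace ℝ (Fin n)))
      (Φ : EuclideanSpace ℝ (Fin n) → EuclideanSpace ℝ (Fin n)) (z : EuclideanSpace ℝ (Fin n))
      (σ ρ : ℝ), 0 < σ → σ ≤ σ₀ → ρ ≤ Λ * σ → ENNReal.ofReal τ ≤ reach M →
      IsTubeMap M κ ρ Φ z r B → IsNearTangent M κ ρ Φ z σ ξ Lperp Ccurv →
      s₀ ≤ tangentSignal M Φ z ξ →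
      secantDeviation M Φ z σ ξ ≤
        Lperp * ρ * ‖colMatrix ξ‖ / tangentSignal M Φ z ξ +
          Ccurv * κ * σ * ‖colMatrix ξ‖ ^ 2 / tangentSignal M Φ z ξ +
        C₃ * σ ^ 2 * ‖colMatrix ξ‖ ^ 3 / tangentSignal M Φ z ξ := by
  set X := ‖colMatrix ξ‖
  set K := Λ / τ + k * B * X ^ 2 * (1 + r) / (2 * s₀) with hK
  set A := |Lperp| * Λ * X + |Ccurv| * |κ| * X ^ 2 with hA
  obtain ⟨σ₀, hσ₀, hsmall⟩ := exists_pos_forall_mul_lt_and_mul_lt X K hr one_half_pos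
  refine ⟨2 * K * A / X ^ 3 + k * B, by positivity, σ₀, hσ₀,
    fun M Φ z σ ρ hσ hσle hρ hM hΦ hN hs => ?_⟩
  obtain ⟨hσr, hσK⟩ := hsmall σ hσ hσle
  have hs0 : 0 < tangentSignal M Φ z ξ := hs₀.trans_le hs
  have hX : 0 < X := norm_colMatrix_pos_of_tangentSignal_pos hk hs0
  have hρτ : ρ / τ ≤ Λ * σ / τ := by gcongr
  have hdev := secantDeviation_le_one_add_two_mul hM hτ hΦ hN hσ hr hσr hs₀ hs hσK.le
    (by rw [hK]; linear_combination hρτ)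
  have hprincipal := principal_le_abs_mul (Lperp := Lperp) (Ccurv := Ccurv) hΦ.radius_nonneg
    hΦ.curvature.1 hσ.le hX.le hs0 le_rfl hρ (le_abs_self κ)
  -- The relative error `2Kσ` acts on principal terms of size `Aσ / s`, so its effect is `O(σ²)`.
  have habsorb : 2 * (K * σ) * (Lperp * ρ * X / tangentSignal M Φ z ξ +
      Ccurv * κ * σ * X ^ 2 / tangentSignal M Φ z ξ) ≤
      2 * K * A / X ^ 3 * σ ^ 2 * X ^ 3 / tangentSignal M Φ z ξ :=
    calc _ ≤ 2 * (K * σ) * ((|Lperp| * (Λ * σ) * X + |Ccurv| * |κ| * σ * X ^ 2) /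
          tangentSignal M Φ z ξ) := by gcongr
      _ = _ := by rw [hA]; field_simp
  linear_combination hdev + habsorb

end Asymptotics

theorem mainTheorem1_general (n k : ℕ) (hk : 1 ≤ k) (B : ℝ) (hB : 0 ≤ B) :
    (∃ C₃ : ℝ, 0 ≤ C₃ ∧
      ∀ (ξ : Fin k → EuclideanSpace ℝ (Fin n)) (τ r s₀ : ℝ), 0 < τ → 0 < r → 0 < s₀ →
        (∀ ε : ℝ, 0 < ε → ∃ σ₀ > 0, ∃ ρ₀ > 0,
          ∀ (M : Set (EuclideanSpace ℝ (Fin n)))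
            (Φ : EuclideanSpace ℝ (Fin n) → EuclideanSpace ℝ (Fin n))
            (z : EuclideanSpace ℝ (Fin n)) (κ Lperp Ccurv σ ρ : ℝ),
            0 < σ → σ ≤ σ₀ → ρ ≤ ρ₀ →
            ENNReal.ofReal τ ≤ reach M →
            IsTubeMap M κ ρ Φ z r B →
            IsNearTangent M κ ρ Φ z σ ξ Lperp Ccurv →
            s₀ ≤ tangentSignal M Φ z ξ →
            secantDeviation M Φ z σ ξ ≤
              (1 + ε) * (Lperp * ρ * ‖colMatrix ξ‖ / tangentSignal M Φ z ξ
                + Ccurv * κ * σ * ‖colMatrix ξ‖ ^ 2 / tangentSignal M Φ z ξ)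
              + C₃ * σ ^ 2 * ‖colMatrix ξ‖ ^ 3 / tangentSignal M Φ z ξ) ∧
        (∃ σ₀ > 0, ∀ σ Lperp Ccurv η : ℝ, 0 < σ → σ ≤ σ₀ → 0 < η → ∃ δ > 0,
          ∀ (M : Set (EuclideanSpace ℝ (Fin n)))
            (Φ : EuclideanSpace ℝ (Fin n) → EuclideanSpace ℝ (Fin n))
            (z : EuclideanSpace ℝ (Fin n)) (κ ρ : ℝ),
            ρ ≤ δ → κ ≤ δ →
            ENNReal.ofReal τ ≤ reach M →
            IsTubeMap M κ ρ Φ z r B →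
            IsNearTangent M κ ρ Φ z σ ξ Lperp Ccurv →
            s₀ ≤ tangentSignal M Φ z ξ →
            secantDeviation M Φ z σ ξ ≤
              C₃ * σ ^ 2 * ‖colMatrix ξ‖ ^ 3 / tangentSignal M Φ z ξ + η)) ∧
    (∀ (ξ : Fin k → EuclideanSpace ℝ (Fin n)) (τ r s₀ κ Lperp Ccurv Λ : ℝ),
        0 < τ → 0 < r → 0 < s₀ → 0 < Λ →
        ∃ C₃ : ℝ, 0 ≤ C₃ ∧ ∃ σ₀ > 0, ∃ ρ₀ > 0,
          ∀ (M : Set (EuclideanSpace ℝ (Fin n)))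
            (Φ : EuclideanSpace ℝ (Fin n) → EuclideanSpace ℝ (Fin n))
            (z : EuclideanSpace ℝ (Fin n)) (σ ρ : ℝ),
            0 < σ → σ ≤ σ₀ → ρ ≤ ρ₀ → ρ ≤ Λ * σ →
            ENNReal.ofReal τ ≤ reach M →
            IsTubeMap M κ ρ Φ z r B →
            IsNearTangent M κ ρ Φ z σ ξ Lperp Ccurv →
            s₀ ≤ tangentSignal M Φ z ξ →
            secantDeviation M Φ z σ ξ ≤
              Lperp * ρ * ‖colMatrix ξ‖ / tangentSignal M Φ z ξ
              + Ccurv * κ * σ * ‖colMatrix ξ‖ ^ 2 / tangentSignal M Φ z ξ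
              + C₃ * σ ^ 2 * ‖colMatrix ξ‖ ^ 3 / tangentSignal M Φ z ξ) ∧
    (∀ (ξ : Fin k → EuclideanSpace ℝ (Fin n)) (Lperp Ccurv σ s : ℝ), 0 < σ → 0 < s →
        Tendsto (fun ρ : ℝ => Lperp * ρ * ‖colMatrix ξ‖ / s) (𝓝[>] 0) (𝓝 0) ∧
        Tendsto (fun κ : ℝ => Ccurv * κ * σ * ‖colMatrix ξ‖ ^ 2 / s) (𝓝[≥] 0) (𝓝 0)) := by
  refine ⟨⟨k * B, by positivity, fun ξ τ r s₀ hτ hr hs₀ =>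
    ⟨fun ε hε => exists_secantDeviation_le B ξ hτ hr hs₀ hε,
      exists_secantDeviation_le_of_radius_le_of_curvature_le B ξ hτ hr hs₀⟩⟩,
    fun ξ τ r s₀ κ Lperp Ccurv Λ hτ hr hs₀ hΛ => ?_, fun ξ Lperp Ccurv σ s _ _ => ?_⟩
  · obtain ⟨C₃, hC₃, σ₀, hσ₀, h⟩ :=
      exists_secantDeviation_le_of_radius_le_mul hk hB ξ hτ hr hs₀ hΛ.le
    exact ⟨C₃, hC₃, σ₀, hσ₀, 1, one_pos, fun M Φ z σ ρ hσ hσle _ => h M Φ z σ ρ hσ hσle⟩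
  · constructor <;>
      exact ((by fun_prop : Continuous _).tendsto' 0 0 (by simp)).mono_left nhdsWithin_le_nhds

theorem mainTheorem1 (n d k : ℕ) (hk : 1 ≤ k) (hkd : k ≤ d) (B : ℝ) (hB : 0 ≤ B) :
    (∃ C₃ : ℝ, 0 ≤ C₃ ∧
      ∀ (ξ : Fin k → EuclideanSpace ℝ (Fin n)) (τ r s₀ : ℝ), 0 < τ → 0 < r → 0 < s₀ →
        -- `σ` and `ρ` small independently of each other
        (∀ ε : ℝ, 0 < ε → ∃ σ₀ > 0, ∃ ρ₀ > 0,
          ∀ (M : Set (EuclideanSpace ℝ (Fin n)))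
            (Φ : EuclideanSpace ℝ (Fin n) → EuclideanSpace ℝ (Fin n))
            (z : EuclideanSpace ℝ (Fin n)) (κ Lperp Ccurv σ ρ : ℝ),
            0 < σ → σ ≤ σ₀ → ρ ≤ ρ₀ →
            ENNReal.ofReal τ ≤ reach M →
            IsTubeFlow d M κ ρ Φ z r B →
            IsNearTangent M κ ρ Φ z σ ξ Lperp Ccurv →
            s₀ ≤ tangentSignal M Φ z ξ →
            secantDeviation M Φ z σ ξ ≤
              (1 + ε) * (Lperp * ρ * ‖colMatrix ξ‖ / tangentSignal M Φ z ξ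
                + Ccurv * κ * σ * ‖colMatrix ξ‖ ^ 2 / tangentSignal M Φ z ξ)
              + C₃ * σ ^ 2 * ‖colMatrix ξ‖ ^ 3 / tangentSignal M Φ z ξ) ∧
        -- `ρ, κ → 0` for fixed small `σ`: only the last term remains
        (∃ σ₀ > 0, ∀ σ Lperp Ccurv η : ℝ, 0 < σ → σ ≤ σ₀ → 0 < η → ∃ δ > 0,
          ∀ (M : Set (EuclideanSpace ℝ (Fin n)))
            (Φ : EuclideanSpace ℝ (Fin n) → EuclideanSpace ℝ (Fin n))
            (z : EuclideanSpace ℝ (Fin n)) (κ ρ : ℝ),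
            ρ ≤ δ → κ ≤ δ →
            ENNReal.ofReal τ ≤ reach M →
            IsTubeFlow d M κ ρ Φ z r B →
            IsNearTangent M κ ρ Φ z σ ξ Lperp Ccurv →
            s₀ ≤ tangentSignal M Φ z ξ →
            secantDeviation M Φ z σ ξ ≤
              C₃ * σ ^ 2 * ‖colMatrix ξ‖ ^ 3 / tangentSignal M Φ z ξ + η)) ∧
    -- smallness of `σ`, with `ρ` at most a fixed multiple of `σ`; `C₃` does not depend on `σ, ρ`
    (∀ (ξ : Fin k → EuclideanSpace ℝ (Fin n)) (τ r s₀ κ Lperp Ccurv Λ : ℝ),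
        0 < τ → 0 < r → 0 < s₀ → 0 < Λ →
        ∃ C₃ : ℝ, 0 ≤ C₃ ∧ ∃ σ₀ > 0, ∃ ρ₀ > 0,
          ∀ (M : Set (EuclideanSpace ℝ (Fin n)))
            (Φ : EuclideanSpace ℝ (Fin n) → EuclideanSpace ℝ (Fin n))
            (z : EuclideanSpace ℝ (Fin n)) (σ ρ : ℝ),
            0 < σ → σ ≤ σ₀ → ρ ≤ ρ₀ → ρ ≤ Λ * σ →
            ENNReal.ofReal τ ≤ reach M →
            IsTubeFlow d M κ ρ Φ z r B →
            IsNearTangent M κ ρ Φ z σ ξ Lperp Ccurv →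
            s₀ ≤ tangentSignal M Φ z ξ →
            secantDeviation M Φ z σ ξ ≤
              Lperp * ρ * ‖colMatrix ξ‖ / tangentSignal M Φ z ξ
              + Ccurv * κ * σ * ‖colMatrix ξ‖ ^ 2 / tangentSignal M Φ z ξ
              + C₃ * σ ^ 2 * ‖colMatrix ξ‖ ^ 3 / tangentSignal M Φ z ξ) ∧
    -- the first two terms vanish as `ρ, κ → 0` for fixed `σ`
    (∀ (ξ : Fin k → EuclideanSpace ℝ (Fin n)) (Lperp Ccurv σ s : ℝ), 0 < σ → 0 < s →
        Tendsto (fun ρ : ℝ => Lperp * ρ * ‖colMatrix ξ‖ / s) (𝓝[>] 0) (𝓝 0) ∧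
        Tendsto (fun κ : ℝ => Ccurv * κ * σ * ‖colMatrix ξ‖ ^ 2 / s) (𝓝[≥] 0) (𝓝 0)) := by
  refine (?_ : _ → _) (mainTheorem1_general n k hk B hB)
  gcongr <;> exact fun h => h.isTubeMap ‹0 < r›
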